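/- For $k\in\omega$, let $S_k$ be the first-order theory in the language $\langle\in\rangle$ (with equality) axiomatized by - $(V_0)$ and $(V_k)$, where $(V_n)$ is $\forall x_0,\dots,x_{n-1}\,\exists y\,\forall t\,\bigl(t\in y\leftrightarrow\bigvee_{i<n}t=x_i\bigr)$; - $(E)$: $\forall x,y\,\bigl(\forall t\,(t\in x\leftrightarrow t\in y)\to x=y\bigr)$; - $(B_k)$: $\forall x,u_0,\dots,u_k\,\bigl(\bigwedge_{i\le k}u_i\in x\to\bigvee_{i<j\le k}u_i=u_j\bigr)$; - $(C_n)$ for every $n\ge1$: $\forall x_0,\dots,x_n\,\neg\bigl(\bigwedge_{i<n}x_i\in x_{i+1}\land x_n=x_0\bigr)$. For an infinite cardinal $\kappa$, a theory $T$ is called $\kappa$-stable if for every model $M\models T$ and every $A\subseteq M$ with $|A|\le\kappa$, there are at most $\kappa$ complete $1$-types of $M$ over $A$; $T$ is called stable if it is $\kappa$-stable for some $\kappa\ge\|T\|$, where $\|T\|$ is the maximum of $\aleph_0$ and the number of symbols of the language of $T$. Let $k\ge2$. Then: 1. for every infinite cardinal $\kappa$, every model $M\models S_k$, and every $A\subseteq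 M$ with $|A|\le\kappa$, there are at most $\kappa^{\aleph_0}$ complete $1$-types of $M$ over $A$; 2. consequently, $S_k$ is $\kappa$-stable for every infinite cardinal $\kappa$ such that $\kappa^{\aleph_0}=\kappa$; 3. in particular, $S_k$ is stable. -/

import Mathlib

open FirstOrder Cardinal

universe u v w

namespace VaughtSets

/-! ### Stability of first-order theories -/

section Stability

open FirstOrder.Language

variable {L : FirstOrder.Language.{u, v}}

/-- The complete 1-types of the structure `M` over the parameter set `A`: complete types in one
variable, in the language `L` expanded by constants for the elements of `A`, over the complete
theory of the expanded structure `(M, a)_{a ∈ A}`. -/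
abbrev OneTypes (L : FirstOrder.Language.{u, v}) (M : Type w) [L.Structure M] (A : Set M) :=
  (L[[A]].completeTheory M).CompleteType (Fin 1)

/-- `T` is `κ`-stable: for every model `M` of `T` and every `A ⊆ M` with `|A| ≤ κ`, there are at
most `κ` complete 1-types of `M` over `A`. (Meant for infinite `κ`.) -/
def IsKappaStable (T : L.Theory) (κ : Cardinal.{max u v w}) : Prop :=
  ∀ (M : Type (max u v w)) [L.Structure M], M ⊨ T → ∀ A : Set M, #A ≤ κ → #(OneTypes L M A) ≤ κ

/-- `T` is stable: it is `κ`-stable for some `κ ≥ ‖T‖`, where `‖T‖` is the larger of `ℵ₀` and the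
number of symbols in the language of `T`. -/
def IsStable (T : L.Theory) : Prop :=
  ∃ κ : Cardinal.{max u v w},
    Cardinal.lift.{w} (max ℵ₀ L.card) ≤ κ ∧ IsKappaStable.{u, v, w} T κ

end Stability

/-! ### The theories `S_k` -/

open FirstOrder.Language

/-- The relation symbols of the language of set theory: one binary symbol. -/
inductive SetRel : ℕ → Type
  | mem : SetRel 2

/-- The language `⟨∈⟩` of set theory. -/
def setLang : FirstOrder.Language.{0, 0} := ⟨fun _ => Empty, SetRel⟩

/-- The atomic formula `s ∈ t`. -/
def memF {n : ℕ} (s t : setLang.Term (Empty ⊕ Fin n)) : setLang.BoundedFormula Empty n :=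
  Relations.boundedFormula₂ (L := setLang) SetRel.mem s t

/-- The axiom `(V_n)`: `∀ x₀ … xₙ₋₁ ∃ y ∀ t (t ∈ y ↔ ⋁_{i < n} t = xᵢ)`.
Here `xᵢ`, `y`, `t` are the bound variables with indices `i`, `n`, `n + 1`. -/
noncomputable def axV (n : ℕ) : setLang.Sentence :=
  let t : Fin (n + 2) := Fin.last (n + 1)
  let y : Fin (n + 2) := (Fin.last n).castSucc
  let x : Fin n → Fin (n + 2) := fun i => i.castSucc.castSucc
  (∃' ∀' ((memF (&t) (&y)).iff (BoundedFormula.iSup fun i : Fin n => (&t) =' (&(x i)))) :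
    setLang.BoundedFormula Empty n).alls

/-- The extensionality axiom `(E)`: `∀ x y (∀ t (t ∈ x ↔ t ∈ y) → x = y)`. -/
def axE : setLang.Sentence :=
  ((∀' ((memF (&2) (&0)).iff (memF (&2) (&1)))).imp ((&0) =' (&1)) :
    setLang.BoundedFormula Empty 2).alls

/-- The boundedness axiom `(B_k)`:
`∀ x u₀ … u_k (⋀_{i ≤ k} uᵢ ∈ x → ⋁_{i < j ≤ k} uᵢ = uⱼ)`.
Here `x`, `uᵢ` are the bound variables with indices `0`, `i + 1`. -/
noncomputable def axB (k : ℕ) : setLang.Sentence :=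
  let u : Fin (k + 1) → Fin (k + 2) := Fin.succ
  ((BoundedFormula.iInf fun i : Fin (k + 1) => memF (&(u i)) (&0)).imp
    (BoundedFormula.iSup fun p : {p : Fin (k + 1) × Fin (k + 1) // p.1 < p.2} =>
      (&(u p.1.1)) =' (&(u p.1.2))) : setLang.BoundedFormula Empty (k + 2)).alls

/-- The acyclicity axiom `(C_n)`: `∀ x₀ … xₙ ¬(⋀_{i < n} xᵢ ∈ xᵢ₊₁ ∧ xₙ = x₀)`. -/
noncomputable def axC (n : ℕ) : setLang.Sentence :=
  (((BoundedFormula.iInf fun i : Fin n => memF (&i.castSucc) (&i.succ)) ⊓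
    ((&(Fin.last n)) =' (&0))).not : setLang.BoundedFormula Empty (n + 1)).alls

/-- The theory `S_k`, axiomatized by `(V_0)`, `(V_k)`, `(E)`, `(B_k)` and `(C_n)` for `n ≥ 1`. -/
def theoryS (k : ℕ) : setLang.Theory :=
  {axV 0, axV k, axE, axB k} ∪ {φ | ∃ n : ℕ, 1 ≤ n ∧ φ = axC n}

end VaughtSets

/-! In a model of `S_k` a point is its set of at most `k` elements, every set of at most `k` points
is a point, and membership has no cycles. Membership need not be well-founded, but up to any finite
depth a point has only finitely many descendants.

First-order truth is local: for each formula there are a depth `D` and finitely many free variables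
such that its truth is preserved by every isomorphism between the descendants of the relevant values
up to depth `D` (`exists_isPreserved`). The quantifier step is a back-and-forth argument resting on
`exists_extend`: a partial isomorphism of large depth extends to one more point `z`, at the price of
depth. Descendants of `z` already near the old points keep their images. The new bottom ones go to
fresh points, and everything above them is determined by extensionality and the existence of small
sets.

Numbering elements by `Fin k` names descendants by finite words. By locality, a type of `x` over `A`
is determined by the equations between words applied to `x`, and between these and words applied to
points of `A`. There are countably many words, and for each at most `κ` parameter descendants it can
equal, hence at most `κ ^ ℵ₀` types. Types not realized in `M` are represented by ultrafilters on
`M`, so no elementary extension has to be analysed. -/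

namespace VaughtSets

/-! ### Partial isomorphisms of finite depth and their extension -/

section Combinatorics

open Relation

/-- `ch` sends each point of `M` to its finite set of elements, in such a way that `M` becomes a
model of the theory of acyclic extensional sets with at most `k` elements. -/
structure IsBoundedSetModel {M : Type*} (k : ℕ) (ch : M → Finset M) : Prop where
  pos : 1 ≤ k
  ext : Function.Injective ch
  card_le : ∀ x, (ch x).card ≤ k
  exists_eq : ∀ t : Finset M, t.card ≤ k → ∃ x, ch x = t
  acyclic : ∀ x, ¬ TransGen (fun a b => a ∈ ch b) x x

variable {M : Type*} [DecidableEq M] {k : ℕ} {ch : M → Finset M}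

/-- The points reachable from `S` by descending at most `n` times to an element. -/
def descend (ch : M → Finset M) : ℕ → Finset M → Finset M
  | 0, S => S
  | n + 1, S => descend ch n S ∪ (descend ch n S).biUnion ch

theorem descend_subset_succ (n : ℕ) (S : Finset M) : descend ch n S ⊆ descend ch (n + 1) S :=
  Finset.subset_union_left

theorem descend_mono_left {m n : ℕ} (h : m ≤ n) (S : Finset M) :
    descend ch m S ⊆ descend ch n S := by
  induction h with
  | refl => exact Finset.Subset.refl _
  | step _ ih => exact ih.trans (descend_subset_succ _ _)

theorem descend_mono_right (n : ℕ) {S T : Finset M} (h : S ⊆ T) :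
    descend ch n S ⊆ descend ch n T := by
  induction n with
  | zero => exact h
  | succ n ih => exact Finset.union_subset_union ih (Finset.biUnion_subset_biUnion_of_subset_left _ ih)

theorem mem_descend_of_mem_ch {n : ℕ} {S : Finset M} {x y : M} (hx : x ∈ descend ch n S)
    (hy : y ∈ ch x) : y ∈ descend ch (n + 1) S :=
  Finset.mem_union_right _ (Finset.mem_biUnion.2 ⟨x, hx, hy⟩)

theorem mem_descend_succ {n : ℕ} {S : Finset M} {y : M} :
    y ∈ descend ch (n + 1) S ↔ y ∈ descend ch n S ∨ ∃ x ∈ descend ch n S, y ∈ ch x := by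
  simp [descend]

theorem descend_union (n : ℕ) (S T : Finset M) :
    descend ch n (S ∪ T) = descend ch n S ∪ descend ch n T := by
  induction n with
  | zero => rfl
  | succ n ih =>
    ext y
    simp only [mem_descend_succ, Finset.mem_union, ih]
    grind

theorem card_descend_le (hM : IsBoundedSetModel k ch) (n : ℕ) (S : Finset M) :
    (descend ch n S).card ≤ (k + 1) ^ n * S.card := by
  induction n with
  | zero => simp [descend]
  | succ n ih =>
    have h1 : ((descend ch n S).biUnion ch).card ≤ (descend ch n S).card * k :=
      Finset.card_biUnion_le_card_mul _ _ _ fun x _ => hM.card_le x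
    have h2 := Finset.card_union_le (descend ch n S) ((descend ch n S).biUnion ch)
    calc (descend ch (n + 1) S).card ≤ (k + 1) * (descend ch n S).card := by
          rw [descend]; linarith
      _ ≤ (k + 1) * ((k + 1) ^ n * S.card) := Nat.mul_le_mul_left _ ih
      _ = _ := by ring

/-- `f` is an isomorphism of the descendants of `S` up to depth `D` onto those of `f '' S`. -/
def PartialIso (ch : M → Finset M) (D : ℕ) (S : Finset M) (f : M → M) : Prop :=
  Set.InjOn f (descend ch D S) ∧
    ∀ n < D, ∀ u ∈ descend ch n S, ch (f u) = (ch u).image f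

theorem PartialIso.mono {D D' : ℕ} {S S' : Finset M} {f : M → M} (h : PartialIso ch D S f)
    (hD : D' ≤ D) (hS : S' ⊆ S) : PartialIso ch D' S' f :=
  ⟨h.1.mono (Finset.coe_subset.2 ((descend_mono_left hD _).trans (descend_mono_right _ hS))),
    fun n hn u hu => h.2 n (hn.trans_le hD) u (descend_mono_right _ hS hu)⟩

theorem PartialIso.descend_image {D : ℕ} {S : Finset M} {f : M → M} (h : PartialIso ch D S f)
    {n : ℕ} (hn : n ≤ D) : descend ch n (S.image f) = (descend ch n S).image f := by
  induction n with
  | zero => rfl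
  | succ n ih =>
    rw [descend, descend, ih (by omega), Finset.image_union, Finset.image_biUnion,
      Finset.biUnion_image]
    congr 1
    exact Finset.biUnion_congr rfl fun u hu => h.2 n hn u hu

/-- Taking images commutes with `descend` up to depth `D`, so the inverse of `f` on these
descendants is again a partial isomorphism. This reduces the back-and-forth to one direction. -/
theorem PartialIso.symm {D : ℕ} {S : Finset M} {f : M → M} (h : PartialIso ch D S f) :
    ∃ g, PartialIso ch D (S.image f) g ∧ ∀ u ∈ S, g (f u) = u := by
  classical
  rcases S.eq_empty_or_nonempty with rfl | ⟨s, _⟩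
  · exact ⟨f, by simpa using h, by simp⟩
  have : Nonempty M := ⟨s⟩
  have hg : ∀ u ∈ descend ch D S, Function.invFunOn f (descend ch D S) (f u) = u :=
    fun u hu => h.1.leftInvOn_invFunOn hu
  refine ⟨Function.invFunOn f (descend ch D S), ⟨?_, ?_⟩,
    fun u hu => hg u (descend_mono_left (Nat.zero_le _) _ hu)⟩
  · rw [h.descend_image le_rfl]
    intro a ha b hb hab
    obtain ⟨a, ha', rfl⟩ := Finset.mem_image.1 (Finset.mem_coe.1 ha)
    obtain ⟨b, hb', rfl⟩ := Finset.mem_image.1 (Finset.mem_coe.1 hb)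
    rw [hg a ha', hg b hb'] at hab
    rw [hab]
  · intro n hn a ha
    rw [h.descend_image hn.le] at ha
    obtain ⟨a, ha', rfl⟩ := Finset.mem_image.1 ha
    rw [hg a (descend_mono_left hn.le _ ha'), h.2 n hn a ha', Finset.image_image]
    ext b
    have : ∀ b ∈ ch a, Function.invFunOn f (descend ch D S) (f b) = b := fun b hb =>
      hg b (descend_mono_left hn _ (mem_descend_of_mem_ch ha' hb))
    rw [Finset.mem_image]
    constructor
    · exact fun hb => ⟨b, hb, this b hb⟩
    · rintro ⟨c, hc, rfl⟩
      rwa [Function.comp, this c hc]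

-- Iterated singletons over the empty set. They supply the fresh values for new leaves, and their
-- only descents run down the chain, so collisions are easy to trace.
omit [DecidableEq M] in
theorem IsBoundedSetModel.exists_singleton_chain (hM : IsBoundedSetModel k ch) :
    ∃ s : ℕ → M, Function.Injective s ∧ ∀ n, ch (s (n + 1)) = {s n} := by
  obtain ⟨e, he⟩ := hM.exists_eq ∅ (by simp)
  choose sg hsg using fun x : M => hM.exists_eq {x} (by simpa using hM.pos)
  let s : ℕ → M := fun n => sg^[n] e
  have hs : ∀ n, ch (s (n + 1)) = {s n} := fun n => by
    simp only [s, Function.iterate_succ_apply', hsg]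
  have h0 : ∀ n, s 0 ≠ s (n + 1) := fun n h => by
    have := hs n
    rw [← h, show s 0 = e from rfl, he] at this
    exact Finset.singleton_ne_empty _ this.symm
  refine ⟨s, fun m => ?_, hs⟩
  induction m with
  | zero =>
    rintro (_ | n) h
    · rfl
    · exact absurd h (h0 n)
  | succ m ih =>
    rintro (_ | n) h
    · exact absurd h.symm (h0 m)
    · have := hs m
      rw [h, hs n, Finset.singleton_inj] at this
      rw [ih this.symm]

open Classical in
/-- The number of points of `P` hereditarily below `u`, including `u`. -/
noncomputable def rankIn (ch : M → Finset M) (P : Finset M) (u : M) : ℕ :=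
  (P.filter fun x => ReflTransGen (fun a b => a ∈ ch b) x u).card

-- By acyclicity `x` is not below its element `y`, so `x` is lost from the count. Inside a finite
-- set this rank replaces the well-foundedness that may fail in `M`.
omit [DecidableEq M] in
theorem rankIn_lt (hM : IsBoundedSetModel k ch) {P : Finset M} {x y : M} (hx : x ∈ P)
    (hy : y ∈ ch x) : rankIn ch P y < rankIn ch P x := by
  classical
  refine Finset.card_lt_card ⟨fun a ha => ?_, fun h => ?_⟩
  · rw [Finset.mem_filter] at ha ⊢
    exact ⟨ha.1, ha.2.tail hy⟩
  · have := h (Finset.mem_filter.2 ⟨hx, ReflTransGen.refl⟩)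
    exact hM.acyclic x (TransGen.tail' (Finset.mem_filter.1 this).2 hy)

omit [DecidableEq M] in
theorem rankIn_le (P : Finset M) (x : M) : rankIn ch P x ≤ P.card := by
  classical
  exact Finset.card_filter_le _ _

omit [DecidableEq M] in
theorem rankIn_pos {P : Finset M} {x : M} (hx : x ∈ P) : 0 < rankIn ch P x := by
  classical
  exact Finset.card_pos.2 ⟨x, Finset.mem_filter.2 ⟨hx, ReflTransGen.refl⟩⟩

/-- Recursive extension of a map from `C` to the finite set `P`, whose points in `Q` have all
their elements in `P`. -/
theorem IsBoundedSetModel.exists_recursive_map (hM : IsBoundedSetModel k ch) {P Q : Finset M}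
    (hQ : Q ⊆ P) (C : Finset M) (f g : M → M) :
    ∃ f' : M → M, (∀ u ∈ C, f' u = f u) ∧
      (∀ u ∈ Q, u ∉ C → ch (f' u) = (ch u).image f') ∧
      ∀ u, u ∉ Q → u ∉ C → f' u = g u := by
  classical
  -- The guard makes the choice total, with a junk value for large `t`; the recursion only meets
  -- images of some `ch x`, which have at most `k` elements.
  have : ∀ t : Finset M, ∃ x, t.card ≤ k → ch x = t := fun t => by
    by_cases ht : t.card ≤ k
    · obtain ⟨x, hx⟩ := hM.exists_eq t ht
      exact ⟨x, fun _ => hx⟩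
    · obtain ⟨x, -⟩ := hM.exists_eq ∅ (by simp)
      exact ⟨x, fun h => absurd h ht⟩
  choose mk hmk using this
  let R : M → M → Prop := fun y x => x ∈ Q ∧ y ∈ ch x
  have hR : WellFounded R := by
    refine Subrelation.wf (r := InvImage (· < ·) (rankIn ch P)) ?_ (InvImage.wf _ wellFounded_lt)
    exact fun {y x} h => rankIn_lt hM (hQ h.1) h.2
  let F : ∀ x, (∀ y, R y x → M) → M := fun x ih =>
    if x ∈ C then f x
    else if hx : x ∈ Q then mk ((ch x).attach.image fun y => ih y.1 ⟨hx, y.2⟩) else g x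
  have hF : ∀ x, hR.fix F x = F x fun y _ => hR.fix F y := fun x => hR.fix_eq F x
  refine ⟨hR.fix F, fun u hu => ?_, fun u hu hC => ?_, fun u hu hC => ?_⟩
  · rw [hF]; simp only [F, if_pos hu]
  · rw [hF]; simp only [F, if_neg hC, dif_pos hu]
    rw [hmk]
    · ext y
      simp
    · refine Finset.card_image_le.trans ?_
      rw [Finset.card_attach]
      exact hM.card_le u
  · rw [hF]; simp only [F, if_neg hC, dif_neg hu]

/-- Otherwise `g` would increase strictly at `N + 1` successive steps and exceed `N`. -/
theorem exists_eq_succ_of_monotone {N : ℕ} {g : ℕ → ℕ} (hg : Monotone g) (hN : ∀ i, g i ≤ N) :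
    ∃ i ≤ N, g i = g (i + 1) := by
  by_contra! h
  have : ∀ i ≤ N + 1, i ≤ g i := fun i => by
    induction i with
    | zero => simp
    | succ i ih =>
      intro hi
      have h1 := hg (Nat.le_succ i)
      have h2 := h i (by omega)
      have h3 := ih (by omega)
      simp only [Nat.succ_eq_add_one] at h1
      omega
  have h1 := this (N + 1) le_rfl
  have h2 := hN (N + 1)
  omega

/-- Extension of partial isomorphisms: if the intersection of `descend ch D {z}` with the
descendants of `S` does not grow between the depths `c` and `c + N`, a partial isomorphism of depth
`c + N` on `S` extends to one of depth `D` on `insert z S`. -/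
theorem IsBoundedSetModel.exists_extend_of_stable (hM : IsBoundedSetModel k ch) {D c N : ℕ}
    {S : Finset M} {f : M → M} {z : M} (hf : PartialIso ch (c + N) S f) (hDc : D ≤ c)
    (hN : (descend ch D {z}).card ≤ N)
    (hst : ∀ u ∈ descend ch D {z}, u ∈ descend ch (c + N) S → u ∈ descend ch c S) :
    ∃ f', PartialIso ch D (insert z S) f' ∧ ∀ u ∈ S, f' u = f u := by
  classical
  set P := descend ch D {z} with hP
  set C := descend ch (c + N) S with hC
  have hcC : descend ch c S ⊆ C := descend_mono_left (Nat.le_add_right _ _) _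
  -- Points of `Q` are the interior ones, whose images are forced by their elements; points of `P`
  -- outside `Q` and `C` are leaves with free images.
  let Q : Finset M := P.filter fun u => ∃ n < D, u ∈ descend ch n {z}
  have hQP : Q ⊆ P := Finset.filter_subset _ _
  have hQ : ∀ n < D, ∀ u ∈ descend ch n {z}, u ∈ Q := fun n hn u hu =>
    Finset.mem_filter.2 ⟨descend_mono_left hn.le _ hu, n, hn, hu⟩
  have hQch : ∀ u ∈ Q, ∀ y ∈ ch u, y ∈ P := fun u hu y hy => by
    obtain ⟨-, n, hn, hu⟩ := Finset.mem_filter.1 hu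
    exact descend_mono_left hn _ (mem_descend_of_mem_ch hu hy)
  have hNpos : 1 ≤ N := le_trans (Finset.card_pos.2
    ⟨z, descend_mono_left (Nat.zero_le _) _ (Finset.mem_singleton_self z)⟩) hN
  have hrk : ∀ u, rankIn ch P u ≤ N := fun u => (rankIn_le P u).trans hN
  obtain ⟨s, hs_inj, hs⟩ := hM.exists_singleton_chain
  obtain ⟨m₀, hm₀⟩ : ∃ m₀, ∀ m, s m ∈ C.image f → m < m₀ := by
    have hfin : {m | s m ∈ C.image f}.Finite :=
      Set.Finite.preimage hs_inj.injOn (C.image f).finite_toSet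
    obtain ⟨b, hb⟩ := hfin.bddAbove
    exact ⟨b + 1, fun m hm => Nat.lt_succ_of_le (hb hm)⟩
  obtain ⟨e, he⟩ : ∃ e : M → ℕ, Set.InjOn e P :=
    (Set.countable_iff_exists_injOn).1 P.finite_toSet.countable
  -- The offset `m₀ + N` keeps descents of at most `N` steps from a label outside `f '' C`; the
  -- spacing `N + 1` prevents fewer than `N` descents from reaching another label.
  let idx : M → ℕ := fun u => m₀ + N + e u * (N + 1)
  obtain ⟨f', hf'C, hf'Q, hf'l⟩ := hM.exists_recursive_map hQP C f fun u => s (idx u)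
  -- Descend from `u` and `v` together: the rank drops while the depth of `v` grows by one, so the
  -- bound survives. The descent ends at a fresh leaf, or at a set with all its elements in `C`,
  -- where injectivity of `f` and extensionality put `u` itself in `C`.
  have avoid : ∀ r, ∀ u ∈ P, u ∉ C → rankIn ch P u = r → ∀ d, d + r ≤ c + N →
      ∀ v ∈ descend ch d S, f' u ≠ f v := by
    intro r
    induction r using Nat.strong_induction_on with
    | _ r ih =>
      intro u hu huC hr d hd v hv huv
      have hrpos := rankIn_pos (ch := ch) hu
      have hvC : v ∈ C := descend_mono_left (by omega) _ hv
      by_cases huQ : u ∈ Q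
      · have h1 := hf'Q u huQ huC
        rw [huv, hf.2 d (by omega) v hv] at h1
        have hvch : ∀ y ∈ ch v, y ∈ descend ch (d + 1) S := fun y hy =>
          mem_descend_of_mem_ch hv hy
        have hvchC : ∀ y ∈ ch v, y ∈ C := fun y hy =>
          descend_mono_left (by omega) _ (hvch y hy)
        by_cases hall : ∀ y ∈ ch u, y ∈ C
        · have : ch u = ch v := by
            rw [Finset.image_congr (g := f) (fun y hy => hf'C y (hall y hy))] at h1
            ext y
            constructor
            · intro hy
              obtain ⟨x, hx, hxy⟩ := Finset.mem_image.1 (h1 ▸ Finset.mem_image_of_mem f hy)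
              rwa [← hf.1 (hvchC x hx) (hall y hy) hxy]
            · intro hy
              obtain ⟨x, hx, hxy⟩ := Finset.mem_image.1 (h1 ▸ Finset.mem_image_of_mem f hy)
              rwa [← hf.1 (hall x hx) (hvchC y hy) hxy]
          exact huC (hM.ext this ▸ hvC)
        · push Not at hall
          obtain ⟨y, hy, hyC⟩ := hall
          obtain ⟨x, hx, hxy⟩ := Finset.mem_image.1 (h1 ▸ Finset.mem_image_of_mem f' hy)
          have hlt := rankIn_lt hM hu hy
          exact ih _ (hr ▸ hlt) y (hQch u huQ y hy) hyC rfl (d + 1) (by omega) x (hvch x hx) hxy.symm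
      · rw [hf'l u huQ huC] at huv
        have := hm₀ _ (huv ▸ Finset.mem_image_of_mem f hvC)
        simp only [idx] at this
        omega
  -- A new point whose image lies high on the singleton chain must sit `t` steps above a leaf `l`,
  -- since `f '' C` only meets the chain below `m₀`.
  have chain : ∀ r, ∀ u ∈ P, u ∉ C → rankIn ch P u = r → ∀ m, m₀ + r ≤ m → f' u = s m →
      ∃ l t, m = idx l + t ∧ t < r ∧ (t = 0 → u ∉ Q) := by
    intro r
    induction r using Nat.strong_induction_on with
    | _ r ih =>
      intro u hu huC hr m hm hum
      have hrpos := rankIn_pos (ch := ch) hu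
      by_cases huQ : u ∈ Q
      · obtain ⟨m, rfl⟩ : ∃ m', m = m' + 1 := ⟨m - 1, by omega⟩
        have h1 := hf'Q u huQ huC
        rw [hum, hs] at h1
        obtain ⟨y, hy, hym⟩ := Finset.mem_image.1 (h1 ▸ Finset.mem_singleton_self (s m))
        have hlt := rankIn_lt hM hu hy
        by_cases hyC : y ∈ C
        · have := hm₀ m (by rw [← hym, hf'C y hyC]; exact Finset.mem_image_of_mem f hyC)
          omega
        · obtain ⟨l, t, h2, h3, -⟩ :=
            ih _ (hr ▸ hlt) y (hQch u huQ y hy) hyC rfl m (by omega) hym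
          exact ⟨l, t + 1, by omega, by omega, by omega⟩
      · refine ⟨u, 0, ?_, by omega, fun _ => huQ⟩
        rw [hf'l u huQ huC] at hum
        exact (hs_inj hum).symm
  have leaf : ∀ u ∈ P, u ∉ C → u ∉ Q → ∀ v ∈ P, v ∉ C → f' u = f' v → v ∉ Q := by
    intro u hu huC huQ v hv hvC huv
    rw [hf'l u huQ huC] at huv
    have h1 := hrk v
    obtain ⟨l, t, h2, h3, h4⟩ := chain _ v hv hvC rfl (idx u) (by simp only [idx]; omega) huv.symm
    refine h4 ?_
    simp only [idx] at h2
    have h5 : e u * (N + 1) = e l * (N + 1) + t := by omega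
    have h6 : (e u * (N + 1)) % (N + 1) = t := by
      rw [h5, Nat.mul_add_mod_self_right, Nat.mod_eq_of_lt (by omega)]
    rw [← h6, Nat.mul_mod_left]
  -- Old points are restricted to depth `c`: `avoid` then applies at depth `c`, because ranks are at
  -- most `N`. Two new points are compared through their elements, which stay in this domain by
  -- `hst`.
  have inj : ∀ r, ∀ u, u ∈ C ∨ u ∈ P → rankIn ch P u = r → (u ∈ C → u ∈ descend ch c S) →
      ∀ v, v ∈ C ∨ v ∈ P → (v ∈ C → v ∈ descend ch c S) → f' u = f' v → u = v := by
    intro r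
    induction r using Nat.strong_induction_on with
    | _ r ih =>
      intro u hu hr huc v hv hvc huv
      by_cases huC : u ∈ C <;> by_cases hvC : v ∈ C
      · rw [hf'C u huC, hf'C v hvC] at huv
        exact hf.1 huC hvC huv
      · rw [hf'C u huC] at huv
        exact absurd huv.symm (avoid _ v (hv.resolve_left hvC) hvC rfl c
          (by have := hrk v; omega) u (huc huC))
      · rw [hf'C v hvC] at huv
        exact absurd huv (avoid _ u (hu.resolve_left huC) huC rfl c
          (by have := hrk u; omega) v (hvc hvC))
      · have huP := hu.resolve_left huC
        have hvP := hv.resolve_left hvC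
        by_cases huQ : u ∈ Q
        · have hvQ : v ∈ Q := by
            by_contra hvQ
            exact leaf v hvP hvC hvQ u huP huC huv.symm huQ
          have h1 := hf'Q u huQ huC
          rw [huv, hf'Q v hvQ hvC] at h1
          have key : ∀ y ∈ ch u, ∀ x ∈ ch v, f' y = f' x → y = x := fun y hy x hx hyx =>
            ih _ (hr ▸ rankIn_lt hM huP hy) y (Or.inr (hQch u huQ y hy)) rfl
              (hst y (hQch u huQ y hy)) x (Or.inr (hQch v hvQ x hx)) (hst x (hQch v hvQ x hx)) hyx
          refine hM.ext (Finset.ext fun y => ⟨fun hy => ?_, fun hy => ?_⟩)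
          · obtain ⟨x, hx, hxy⟩ := Finset.mem_image.1 (h1 ▸ Finset.mem_image_of_mem f' hy)
            rwa [key y hy x hx hxy.symm]
          · obtain ⟨x, hx, hxy⟩ := Finset.mem_image.1 (h1 ▸ Finset.mem_image_of_mem f' hy)
            rwa [← key x hx y hy hxy]
        · have hvQ := leaf u huP huC huQ v hvP hvC huv
          rw [hf'l u huQ huC, hf'l v hvQ hvC] at huv
          have h1 := hs_inj huv
          simp only [idx] at h1
          have h2 : e u * (N + 1) = e v * (N + 1) := by omega
          exact he huP hvP (Nat.eq_of_mul_eq_mul_right (Nat.succ_pos N) h2)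
  have hins : ∀ n, descend ch n (insert z S) = descend ch n {z} ∪ descend ch n S := fun n => by
    rw [Finset.insert_eq, descend_union]
  refine ⟨f', ⟨?_, ?_⟩, fun u hu => hf'C u (descend_mono_left (Nat.zero_le _) _ hu)⟩
  · have hdom : ∀ u ∈ descend ch D (insert z S),
        (u ∈ C ∨ u ∈ P) ∧ (u ∈ C → u ∈ descend ch c S) := by
      intro u hu
      rw [hins] at hu
      rcases Finset.mem_union.1 hu with h | h
      · exact ⟨Or.inr h, hst u h⟩
      · have := descend_mono_left hDc S h
        exact ⟨Or.inl (hcC this), fun _ => this⟩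
    intro u hu v hv huv
    exact inj _ u (hdom u hu).1 rfl (hdom u hu).2 v (hdom v hv).1 (hdom v hv).2 huv
  · intro n hn u hu
    rw [hins] at hu
    have hcap : u ∈ descend ch c S → ch (f' u) = (ch u).image f' := fun h => by
      rw [hf'C u (hcC h), hf.2 c (by omega) u h]
      refine Finset.image_congr fun y hy => (hf'C y ?_).symm
      exact descend_mono_left (by omega) _ (mem_descend_of_mem_ch h hy)
    rcases Finset.mem_union.1 hu with h | h
    · by_cases huC : u ∈ C
      · exact hcap (hst u (descend_mono_left hn.le _ h) huC)
      · exact hf'Q u (hQ n hn u h) huC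
    · exact hcap (descend_mono_left (by omega) _ h)

/-- Pigeonhole: `z` has at most `N = (k + 1) ^ D` descendants to depth `D`, so among `N + 1`
successive depth layers of thickness `N` over `S`, one captures no new descendant of `z`. That gap
feeds `exists_extend_of_stable`. -/
theorem IsBoundedSetModel.exists_extend (hM : IsBoundedSetModel k ch) (D : ℕ) :
    ∃ D', ∀ (S : Finset M) (f : M → M), PartialIso ch D' S f → ∀ z,
      ∃ f', PartialIso ch D (insert z S) f' ∧ ∀ u ∈ S, f' u = f u := by
  set N := (k + 1) ^ D with hN
  refine ⟨D + (N + 1) * N, fun S f hf z => ?_⟩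
  have hcard : (descend ch D {z}).card ≤ N := by simpa using card_descend_le hM D {z}
  let A : ℕ → Finset M := fun i => descend ch D {z} ∩ descend ch (D + i * N) S
  have hA : Monotone A := fun i j hij => Finset.inter_subset_inter_left
    (descend_mono_left (Nat.add_le_add_left (Nat.mul_le_mul_right _ hij) _) _)
  obtain ⟨i, hi, hi'⟩ := exists_eq_succ_of_monotone (g := fun i => (A i).card)
    (fun i j hij => Finset.card_le_card (hA hij))
    (fun i => (Finset.card_le_card Finset.inter_subset_left).trans hcard)
  have hAi : A i = A (i + 1) := Finset.eq_of_subset_of_card_le (hA (Nat.le_succ i)) hi'.ge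
  have hle : D + i * N + N ≤ D + (N + 1) * N := by nlinarith
  refine hM.exists_extend_of_stable (hf.mono hle (Finset.Subset.refl _)) (Nat.le_add_right _ _)
    hcard fun u hu huS => ?_
  have : u ∈ A (i + 1) := Finset.mem_inter.2 ⟨hu, by
    rwa [show D + (i + 1) * N = D + i * N + N by ring]⟩
  rw [← hAi] at this
  exact (Finset.mem_inter.1 this).2

end Combinatorics

/-! ### Models of `S_k` and locality of first-order formulas -/

section Formulas

open FirstOrder.Language Relation

variable {M : Type w} [setLang.Structure M]

/-- The membership relation of a structure for the language of set theory. -/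
def Mem (a b : M) : Prop := Structure.RelMap (L := setLang) SetRel.mem ![a, b]

theorem realize_memF {n : ℕ} (i j : Fin n) (v : Empty → M) (xs : Fin n → M) :
    (memF (Term.var (Sum.inr i)) (Term.var (Sum.inr j))).Realize v xs ↔ Mem (xs i) (xs j) :=
  BoundedFormula.realize_rel₂ (L := setLang)

theorem realize_axV {n : ℕ} :
    M ⊨ axV n ↔ ∀ xs : Fin n → M, ∃ y, ∀ t, Mem t y ↔ ∃ i, t = xs i := by
  simp only [Sentence.Realize, axV, BoundedFormula.realize_alls, BoundedFormula.realize_ex,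
    BoundedFormula.realize_all, BoundedFormula.realize_iff, realize_memF,
    BoundedFormula.realize_iSup, BoundedFormula.realize_bdEqual, Term.realize_var, Sum.elim_inr,
    Function.comp, Fin.snoc_last, Fin.snoc_castSucc]

theorem realize_axE : M ⊨ axE ↔ ∀ x y : M, (∀ t, Mem t x ↔ Mem t y) → x = y := by
  have h : ∀ (xs : Fin 2 → M) (t : M),
      (Fin.snoc xs t : Fin 3 → M) 0 = xs 0 ∧ (Fin.snoc xs t : Fin 3 → M) 1 = xs 1 ∧
        (Fin.snoc xs t : Fin 3 → M) 2 = t := fun xs t =>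
    ⟨Fin.snoc_castSucc (α := fun _ => M) t xs 0, Fin.snoc_castSucc (α := fun _ => M) t xs 1,
      Fin.snoc_last (α := fun _ => M) t xs⟩
  simp only [Sentence.Realize, axE, BoundedFormula.realize_alls, BoundedFormula.realize_imp,
    BoundedFormula.realize_all, BoundedFormula.realize_iff, realize_memF,
    BoundedFormula.realize_bdEqual, Term.realize_var, Sum.elim_inr, Function.comp, h]
  exact ⟨fun H x y => H ![x, y], fun H xs => H (xs 0) (xs 1)⟩

theorem realize_axB {k : ℕ} :
    M ⊨ axB k ↔ ∀ (x : M) (u : Fin (k + 1) → M), (∀ i, Mem (u i) x) →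
      ∃ i j, i < j ∧ u i = u j := by
  simp only [Sentence.Realize, axB, BoundedFormula.realize_alls, BoundedFormula.realize_imp,
    BoundedFormula.realize_iInf, realize_memF, BoundedFormula.realize_iSup,
    BoundedFormula.realize_bdEqual, Term.realize_var, Sum.elim_inr, Function.comp]
  constructor
  · intro H x u hu
    obtain ⟨⟨⟨i, j⟩, hij⟩, h⟩ := H (Fin.cons x u) (by simpa using hu)
    exact ⟨i, j, hij, by simpa using h⟩
  · intro H xs hxs
    obtain ⟨i, j, hij, h⟩ := H (xs 0) (fun i => xs i.succ) hxs
    exact ⟨⟨⟨i, j⟩, hij⟩, h⟩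

theorem realize_axC {n : ℕ} :
    M ⊨ axC n ↔ ∀ xs : Fin (n + 1) → M,
      ¬ ((∀ i : Fin n, Mem (xs i.castSucc) (xs i.succ)) ∧ xs (Fin.last n) = xs 0) := by
  simp only [Sentence.Realize, axC, BoundedFormula.realize_alls, BoundedFormula.realize_not,
    BoundedFormula.realize_inf, BoundedFormula.realize_iInf, realize_memF,
    BoundedFormula.realize_bdEqual, Term.realize_var, Sum.elim_inr, Function.comp]

theorem exists_seq_of_transGen {α : Type*} {r : α → α → Prop} {a b : α} (h : TransGen r a b) :
    ∃ n, 1 ≤ n ∧ ∃ x : ℕ → α, x 0 = a ∧ x n = b ∧ ∀ i < n, r (x i) (x (i + 1)) := by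
  induction h with
  | @single b h =>
    refine ⟨1, le_rfl, fun i => if i = 0 then a else b, by simp, by simp, fun i hi => ?_⟩
    obtain rfl : i = 0 := by omega
    simpa using h
  | @tail b c _ h ih =>
    obtain ⟨n, hn, x, hx0, hxn, hx⟩ := ih
    refine ⟨n + 1, by omega, fun i => if i ≤ n then x i else c, by simpa using hx0, by simp,
      fun i hi => ?_⟩
    rcases Nat.lt_or_ge i n with hin | hin
    · simpa [hin.le, Nat.succ_le_of_lt hin] using hx i hin
    · obtain rfl : i = n := by omega
      simpa [hxn] using h

/-- In a model of `S_k` every point has a finite set of elements. -/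
theorem exists_isBoundedSetModel {k : ℕ} (hk : 1 ≤ k) (hM : M ⊨ theoryS k) :
    ∃ ch : M → Finset M, IsBoundedSetModel k ch ∧ ∀ a b, a ∈ ch b ↔ Mem a b := by
  classical
  have hax : ∀ φ ∈ theoryS k, M ⊨ φ := fun φ hφ => hM.realize_of_mem φ hφ
  have hV0 := realize_axV.1 (hax (axV 0) (by simp [theoryS]))
  have hV := realize_axV.1 (hax (axV k) (by simp [theoryS]))
  have hE := realize_axE.1 (hax axE (by simp [theoryS]))
  have hB := realize_axB.1 (hax (axB k) (by simp [theoryS]))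
  have hC : ∀ n, 1 ≤ n → M ⊨ axC n := fun n hn => hax _ (Or.inr ⟨n, hn, rfl⟩)
  have hcard : ∀ (x : M) (t : Finset M), (∀ a ∈ t, Mem a x) → t.card ≤ k := by
    intro x t ht
    by_contra! hlt
    obtain ⟨t', ht', hcard⟩ := Finset.exists_subset_card_eq (Nat.succ_le_of_lt hlt)
    let e := t'.equivFinOfCardEq hcard
    obtain ⟨i, j, hij, h⟩ := hB x (fun i => (e.symm i : M)) fun i => ht _ (ht' (e.symm i).2)
    exact hij.ne (e.symm.injective (Subtype.ext h))
  have hfin : ∀ x : M, {a : M | Mem a x}.Finite := by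
    intro x
    by_contra hinf
    obtain ⟨t, ht, htc⟩ := Set.Infinite.exists_subset_card_eq hinf (k + 1)
    have := hcard x t fun a ha => ht ha
    omega
  refine ⟨fun x => (hfin x).toFinset, ⟨hk, ?_, ?_, ?_, ?_⟩, fun a b => by simp⟩
  · intro x y hxy
    refine hE x y fun t => ?_
    have : t ∈ (hfin x).toFinset ↔ t ∈ (hfin y).toFinset := by
      rw [show (hfin x).toFinset = (hfin y).toFinset from hxy]
    simpa using this
  · exact fun x => hcard x _ fun a ha => by simpa using ha
  · intro t ht
    -- `(V_k)` with repeated entries yields only nonempty sets, since `k ≥ 1`; the empty set comes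
    -- from `(V_0)`.
    rcases t.eq_empty_or_nonempty with rfl | ⟨a, ha⟩
    · obtain ⟨y, hy⟩ := hV0 Fin.elim0
      exact ⟨y, by ext b; simp [hy]⟩
    · let e := t.equivFin
      obtain ⟨y, hy⟩ := hV fun i =>
        if h : (i : ℕ) < t.card then (e.symm ⟨i, h⟩ : M) else a
      refine ⟨y, ?_⟩
      ext b
      simp only [Set.Finite.mem_toFinset, Set.mem_ofPred_eq, hy]
      constructor
      · rintro ⟨i, rfl⟩
        split_ifs
        · exact (e.symm _).2
        · exact ha
      · intro hb
        refine ⟨⟨e ⟨b, hb⟩, (e ⟨b, hb⟩).2.trans_le ht⟩, ?_⟩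
        simp
  · intro x hx
    obtain ⟨n, hn, s, hs0, hsn, hs⟩ := exists_seq_of_transGen hx
    refine realize_axC.1 (hC n hn) (fun i => s i) ⟨fun i => ?_, ?_⟩
    · simpa using hs i i.2
    · simp [hs0, hsn]

section Determined

variable [DecidableEq M] {k : ℕ} {ch : M → Finset M} {α : Type*}

/-- The truth of `φ` is preserved by partial isomorphisms of depth `D` on the values of the
variables in `F` and the bound variables. -/
def IsPreserved (ch : M → Finset M) {n : ℕ} (φ : setLang.BoundedFormula α n) (D : ℕ)
    (F : Finset α) : Prop :=
  ∀ (v v' : α → M) (xs xs' : Fin n → M) (f : M → M),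
    PartialIso ch D (F.image v ∪ Finset.univ.image xs) f → (∀ i ∈ F, f (v i) = v' i) →
    (∀ i, f (xs i) = xs' i) → (φ.Realize v xs ↔ φ.Realize v' xs')

theorem IsPreserved.mono {n : ℕ} {φ : setLang.BoundedFormula α n} {D D' : ℕ} {F F' : Finset α}
    (h : IsPreserved ch φ D F) (hD : D ≤ D') (hF : F ⊆ F') : IsPreserved ch φ D' F' :=
  fun v v' xs xs' f hf hv hxs => h v v' xs xs' f
    (hf.mono hD (Finset.union_subset_union (Finset.image_subset_image hF) subset_rfl))
    (fun i hi => hv i (hF hi)) hxs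

theorem isVar_term {β : Type*} (t : setLang.Term β) : ∃ i, t = Term.var i := by
  cases t with
  | var i => exact ⟨i, rfl⟩
  | func f _ => exact f.elim

/-- Every formula is preserved by partial isomorphisms of large enough depth on a large enough
finite set of variables. -/
theorem exists_isPreserved (hM : IsBoundedSetModel k ch) (hmem : ∀ a b, a ∈ ch b ↔ Mem a b)
    {n : ℕ} (φ : setLang.BoundedFormula α n) : ∃ D F, IsPreserved ch φ D F := by
  classical
  have hvar : ∀ {n : ℕ} (i : α ⊕ Fin n), ∃ F : Finset α, ∀ F', F ⊆ F' →
      ∀ (v v' : α → M) (xs xs' : Fin n → M) (f : M → M), (∀ i ∈ F', f (v i) = v' i) →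
      (∀ i, f (xs i) = xs' i) →
      Sum.elim v xs i ∈ F'.image v ∪ Finset.univ.image xs ∧
        f (Sum.elim v xs i) = Sum.elim v' xs' i := by
    rintro n (i | i)
    · refine ⟨{i}, fun F' hF v v' xs xs' f hv hxs => ?_⟩
      have hi : i ∈ F' := hF (Finset.mem_singleton_self i)
      exact ⟨Finset.mem_union_left _ (Finset.mem_image_of_mem v hi), hv i hi⟩
    · exact ⟨∅, fun F' _ v v' xs xs' f _ hxs =>
        ⟨Finset.mem_union_right _ (Finset.mem_image_of_mem xs (Finset.mem_univ i)), hxs i⟩⟩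
  induction φ with
  | falsum => exact ⟨0, ∅, fun _ _ _ _ _ _ _ _ => Iff.rfl⟩
  | @equal n t₁ t₂ =>
    obtain ⟨i, rfl⟩ := isVar_term t₁
    obtain ⟨j, rfl⟩ := isVar_term t₂
    obtain ⟨F₁, h₁⟩ := hvar i
    obtain ⟨F₂, h₂⟩ := hvar j
    refine ⟨0, F₁ ∪ F₂, fun v v' xs xs' f hf hv hxs => ?_⟩
    obtain ⟨hi, hi'⟩ := h₁ _ Finset.subset_union_left v v' xs xs' f hv hxs
    obtain ⟨hj, hj'⟩ := h₂ _ Finset.subset_union_right v v' xs xs' f hv hxs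
    change Sum.elim v xs i = Sum.elim v xs j ↔ Sum.elim v' xs' i = Sum.elim v' xs' j
    rw [← hi', ← hj']
    exact (hf.1.eq_iff hi hj).symm
  | @rel n l R ts =>
    cases R
    obtain ⟨i, hi⟩ := isVar_term (ts 0)
    obtain ⟨j, hj⟩ := isVar_term (ts 1)
    obtain ⟨F₁, h₁⟩ := hvar i
    obtain ⟨F₂, h₂⟩ := hvar j
    have hreal : ∀ (v : α → M) (xs : Fin n → M),
        (BoundedFormula.rel (L := setLang) SetRel.mem ts).Realize v xs ↔
          Sum.elim v xs i ∈ ch (Sum.elim v xs j) := by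
      intro v xs
      rw [hmem, Mem]
      refine iff_of_eq (congrArg (Structure.RelMap (L := setLang) SetRel.mem) (funext fun a => ?_))
      fin_cases a
      · simp [hi]
      · simp [hj]
    -- Depth 1 is needed so that `f` respects the elements of the right-hand term and is injective
    -- on them.
    refine ⟨1, F₁ ∪ F₂, fun v v' xs xs' f hf hv hxs => ?_⟩
    obtain ⟨hi, hi'⟩ := h₁ _ Finset.subset_union_left v v' xs xs' f hv hxs
    obtain ⟨hj, hj'⟩ := h₂ _ Finset.subset_union_right v v' xs xs' f hv hxs
    rw [hreal, hreal, ← hi', ← hj', hf.2 0 one_pos _ hj, Finset.mem_image]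
    refine ⟨fun h => ⟨_, h, rfl⟩, fun ⟨a, ha, hai⟩ => ?_⟩
    rwa [← hf.1 (mem_descend_of_mem_ch (n := 0) hj ha) (descend_subset_succ 0 _ hi) hai]
  | @imp n φ ψ ih₁ ih₂ =>
    obtain ⟨D₁, F₁, h₁⟩ := ih₁
    obtain ⟨D₂, F₂, h₂⟩ := ih₂
    refine ⟨max D₁ D₂, F₁ ∪ F₂, fun v v' xs xs' f hf hv hxs => ?_⟩
    rw [BoundedFormula.realize_imp, BoundedFormula.realize_imp,
      h₁.mono (le_max_left _ _) Finset.subset_union_left v v' xs xs' f hf hv hxs,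
      h₂.mono (le_max_right _ _) Finset.subset_union_right v v' xs xs' f hf hv hxs]
  | @all n φ ih =>
    obtain ⟨D, F, h⟩ := ih
    obtain ⟨D', hD'⟩ := hM.exists_extend D
    have hsnoc : ∀ (v : α → M) (xs : Fin n → M) (z : M),
        F.image v ∪ Finset.univ.image (Fin.snoc xs z : Fin (n + 1) → M) ⊆
          insert z (F.image v ∪ Finset.univ.image xs) := by
      intro v xs z
      refine Finset.union_subset (Finset.subset_union_left.trans (Finset.subset_insert _ _)) ?_
      intro a ha
      obtain ⟨i, -, rfl⟩ := Finset.mem_image.1 ha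
      refine Fin.lastCases ?_ (fun i => ?_) i
      · simp
      · simp
    -- To test a witness `z`, extend `f` to it and use the hypothesis at its image; the converse is
    -- the same claim for the inverse of `f`.
    have key : ∀ (v v' : α → M) (xs xs' : Fin n → M) (f : M → M),
        PartialIso ch D' (F.image v ∪ Finset.univ.image xs) f → (∀ i ∈ F, f (v i) = v' i) →
        (∀ i, f (xs i) = xs' i) → φ.all.Realize v' xs' → φ.all.Realize v xs := by
      intro v v' xs xs' f hf hv hxs hall z
      obtain ⟨g, hg, hgf⟩ := hD' _ f hf z
      refine (h v v' (Fin.snoc xs z) (Fin.snoc xs' (g z)) g (hg.mono le_rfl (hsnoc v xs z))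
        (fun i hi => ?_) fun i => ?_).2 (hall (g z))
      · rw [hgf _ (Finset.mem_union_left _ (Finset.mem_image_of_mem v hi)), hv i hi]
      · refine Fin.lastCases ?_ (fun i => ?_) i
        · simp
        · simp only [Fin.snoc_castSucc]
          rw [hgf _ (Finset.mem_union_right _ (Finset.mem_image_of_mem xs (Finset.mem_univ i))),
            hxs i]
    refine ⟨D', F, fun v v' xs xs' f hf hv hxs => ⟨?_, key v v' xs xs' f hf hv hxs⟩⟩
    obtain ⟨g, hg, hgf⟩ := hf.symm
    have himg : F.image v' ∪ Finset.univ.image xs' =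
        (F.image v ∪ Finset.univ.image xs).image f := by
      rw [Finset.image_union, Finset.image_image, Finset.image_image]
      congr 1
      · exact Finset.image_congr fun i hi => (hv i hi).symm
      · exact Finset.image_congr fun i _ => (hxs i).symm
    refine key v' v xs' xs g (himg ▸ hg) (fun i hi => ?_) fun i => ?_
    · rw [← hv i hi, hgf _ (Finset.mem_union_left _ (Finset.mem_image_of_mem v hi))]
    · rw [← hxs i,
        hgf _ (Finset.mem_union_right _ (Finset.mem_image_of_mem xs (Finset.mem_univ i)))]

end Determined

end Formulas

/-! ### Descendants named by finite words -/

section Words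

variable {M : Type*} [DecidableEq M] {k : ℕ} {ch : M → Finset M}

omit [DecidableEq M] in
theorem IsBoundedSetModel.notMem_self (hM : IsBoundedSetModel k ch) (x : M) : x ∉ ch x :=
  fun h => hM.acyclic x (Relation.TransGen.single h)

/-- Each point has an enumeration of its elements by `Fin k`, where the empty set is enumerated by
itself. -/
theorem IsBoundedSetModel.exists_enumeration (hM : IsBoundedSetModel k ch) :
    ∃ e : M → Fin k → M, ∀ x, ch x = (Finset.univ.image (e x)).erase x := by
  have key : ∀ x, ∃ g : Fin k → M, ch x = (Finset.univ.image g).erase x := by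
    intro x
    have : Nonempty (Fin k) := ⟨⟨0, hM.pos⟩⟩
    rcases (ch x).eq_empty_or_nonempty with h | ⟨a, ha⟩
    · refine ⟨fun _ => x, ?_⟩
      rw [h, Finset.image_const Finset.univ_nonempty]
      simp
    · let d := (ch x).equivFin
      refine ⟨fun i => if h : (i : ℕ) < (ch x).card then (d.symm ⟨i, h⟩ : M) else a, ?_⟩
      have : (Finset.univ.image fun i : Fin k =>
          if h : (i : ℕ) < (ch x).card then (d.symm ⟨i, h⟩ : M) else a) = ch x := by
        ext b
        simp only [Finset.mem_image, Finset.mem_univ, true_and]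
        constructor
        · rintro ⟨i, rfl⟩
          split_ifs
          · exact (d.symm _).2
          · exact ha
        · intro hb
          exact ⟨⟨d ⟨b, hb⟩, (d ⟨b, hb⟩).2.trans_le (hM.card_le x)⟩, by simp⟩
      rw [this, Finset.erase_eq_of_notMem (hM.notMem_self x)]
  choose e he using key
  exact ⟨e, he⟩

/-- A letter either moves to an element or fixes the point, so words of length at most `n` trace
exactly the descents of at most `n` steps. -/
theorem mem_descend_iff_exists_word {e : M → Fin k → M}
    (he : ∀ x, ch x = (Finset.univ.image (e x)).erase x) {n : ℕ} {S : Finset M} {u : M} :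
    u ∈ descend ch n S ↔ ∃ s ∈ S, ∃ l : List (Fin k), l.length ≤ n ∧ l.foldl e s = u := by
  constructor
  · induction n generalizing u with
    | zero => exact fun hu => ⟨u, hu, [], le_rfl, rfl⟩
    | succ n ih =>
      intro hu
      rcases mem_descend_succ.1 hu with hu | ⟨x, hx, hux⟩
      · obtain ⟨s, hs, l, hl, h⟩ := ih hu
        exact ⟨s, hs, l, by omega, h⟩
      · obtain ⟨s, hs, l, hl, rfl⟩ := ih hx
        rw [he, Finset.mem_erase] at hux
        obtain ⟨i, -, rfl⟩ := Finset.mem_image.1 hux.2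
        exact ⟨s, hs, l ++ [i], by simpa using hl, by simp⟩
  · rintro ⟨s, hs, l, hl, rfl⟩
    refine descend_mono_left hl S ?_
    clear hl
    induction l using List.reverseRecOn with
    | nil => exact hs
    | append_singleton l i ih =>
      rw [List.foldl_append, List.length_append]
      by_cases h : e (l.foldl e s) i = l.foldl e s
      · refine descend_subset_succ _ _ ?_
        rwa [List.foldl_cons, List.foldl_nil, h]
      · refine mem_descend_of_mem_ch ih ?_
        rw [he]
        exact Finset.mem_erase.2 ⟨h, Finset.mem_image_of_mem _ (Finset.mem_univ i)⟩

/-- If the descendants of `x` and `y` up to depth `D` satisfy the same equations among themselves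
and with the descendants of `S`, then there is a partial isomorphism moving `x` to `y` and
fixing `S`. -/
theorem exists_partialIso_of_words {e : M → Fin k → M}
    (he : ∀ x, ch x = (Finset.univ.image (e x)).erase x) {D : ℕ} {S : Finset M} {x y : M}
    (h₁ : ∀ l l' : List (Fin k), l.length ≤ D → l'.length ≤ D →
      (l.foldl e x = l'.foldl e x ↔ l.foldl e y = l'.foldl e y))
    (h₂ : ∀ l l' : List (Fin k), l.length ≤ D → l'.length ≤ D → ∀ s ∈ S,
      (l.foldl e x = l'.foldl e s ↔ l.foldl e y = l'.foldl e s)) :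
    ∃ f, PartialIso ch D (insert x S) f ∧ (∀ s ∈ S, f s = s) ∧ f x = y := by
  classical
  -- Carry each word at `x` to the same word at `y` and fix the rest: `h₁` makes this independent of
  -- the word, `h₂` makes it the identity on descendants of `S`.
  let f : M → M := fun u =>
    if h : ∃ l : List (Fin k), l.length ≤ D ∧ l.foldl e x = u then h.choose.foldl e y else u
  have hfx : ∀ l : List (Fin k), l.length ≤ D → f (l.foldl e x) = l.foldl e y := by
    intro l hl
    have h : ∃ l' : List (Fin k), l'.length ≤ D ∧ l'.foldl e x = l.foldl e x := ⟨l, hl, rfl⟩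
    simp only [f, dif_pos h]
    exact (h₁ _ _ h.choose_spec.1 hl).1 h.choose_spec.2
  have hfS : ∀ u ∈ descend ch D S, f u = u := by
    intro u hu
    by_cases h : ∃ l : List (Fin k), l.length ≤ D ∧ l.foldl e x = u
    · obtain ⟨l, hl, rfl⟩ := h
      obtain ⟨s, hs, l', hl', h⟩ := (mem_descend_iff_exists_word he).1 hu
      rw [hfx l hl, ← h]
      exact (h₂ l l' hl hl' s hs).1 h.symm
    · simp only [f, dif_neg h]
  have hdom : ∀ n, ∀ u ∈ descend ch n (insert x S),
      (∃ l : List (Fin k), l.length ≤ n ∧ l.foldl e x = u) ∨ u ∈ descend ch n S := by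
    intro n u hu
    obtain ⟨s, hs, l, hl, h⟩ := (mem_descend_iff_exists_word he).1 hu
    rcases Finset.mem_insert.1 hs with rfl | hs
    · exact Or.inl ⟨l, hl, h⟩
    · exact Or.inr ((mem_descend_iff_exists_word he).2 ⟨s, hs, l, hl, h⟩)
  have hmix : ∀ l : List (Fin k), l.length ≤ D → ∀ u ∈ descend ch D S,
      l.foldl e y = u → l.foldl e x = u := by
    intro l hl u hu h
    obtain ⟨s, hs, l', hl', rfl⟩ := (mem_descend_iff_exists_word he).1 hu
    exact (h₂ l l' hl hl' s hs).2 h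
  refine ⟨f, ⟨?_, ?_⟩, fun s hs => hfS s (descend_mono_left (Nat.zero_le _) _ hs),
    hfx [] (Nat.zero_le _)⟩
  · intro u hu v hv huv
    rcases hdom D u hu with ⟨l, hl, rfl⟩ | hu <;> rcases hdom D v hv with ⟨l', hl', rfl⟩ | hv
    · rw [hfx l hl, hfx l' hl'] at huv
      exact (h₁ l l' hl hl').2 huv
    · rw [hfx l hl, hfS v hv] at huv
      exact hmix l hl v hv huv
    · rw [hfx l' hl', hfS u hu] at huv
      exact (hmix l' hl' u hu huv.symm).symm
    · rwa [hfS u hu, hfS v hv] at huv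
  · intro n hn u hu
    rcases hdom n u hu with ⟨l, hl, rfl⟩ | hu
    · have happ : ∀ (i : Fin k) (z : M), e (l.foldl e z) i = (l ++ [i]).foldl e z := fun i z => by
        simp
      have hlen : ∀ i : Fin k, (l ++ [i]).length ≤ D := fun i => by simp; omega
      rw [hfx l (by omega), he, he]
      ext b
      simp only [Finset.mem_erase, Finset.mem_image, Finset.mem_univ, true_and]
      constructor
      · rintro ⟨hb, i, rfl⟩
        refine ⟨e (l.foldl e x) i, ⟨fun h => hb ?_, i, rfl⟩, ?_⟩
        · rw [happ] at h ⊢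
          exact (h₁ _ _ (hlen i) (by omega)).1 h
        · rw [happ, happ, hfx _ (hlen i)]
      · rintro ⟨_, ⟨hb, i, rfl⟩, rfl⟩
        rw [happ, hfx _ (hlen i)]
        refine ⟨fun h => hb ?_, i, happ i y⟩
        rw [happ]
        exact (h₁ _ _ (hlen i) (by omega)).2 h
    · rw [hfS u (descend_mono_left hn.le _ hu), Finset.image_congr (g := id), Finset.image_id]
      exact fun v hv => hfS v (descend_mono_left hn _ (mem_descend_of_mem_ch hu hv))

end Words

/-! ### Types as ultrafilters, and counting them -/

section Types

open FirstOrder.Language Filter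

/-- Every complete 1-type over `A ⊆ M` is the set of the formulas that hold for almost all points
of `M` with respect to some ultrafilter. -/
theorem exists_ultrafilter_of_oneType {L : FirstOrder.Language.{u, v}} {M : Type w}
    [L.Structure M] {A : Set M} (p : OneTypes L M A) :
    ∃ U : Ultrafilter M, ∀ φ : L[[A]].Formula (Fin 1),
      Formula.equivSentence φ ∈ p ↔ ∀ᶠ x : M in U, φ.Realize fun _ => x := by
  obtain ⟨N, t, rfl⟩ := Theory.exists_modelType_is_realized_in _ p
  -- The existential closure of `φ` holds in `N`, hence in `M`, whose complete theory `N` satisfies.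
  -- The definable sets of the type therefore generate a proper filter.
  have hsat : ∀ φ : L[[A]].Formula (Fin 1), φ.Realize t → ∃ x : M, φ.Realize fun _ => x := by
    intro φ hφ
    let ψ : L[[A]].Sentence := Formula.iExs (Fin 1) (φ.relabel Sum.inr)
    have hN : N ⊨ ψ := by
      simp only [ψ, Sentence.Realize, Formula.realize_iExs, Formula.realize_relabel]
      exact ⟨t, hφ⟩
    have hM : M ⊨ ψ := by
      by_contra h
      have : ψ.not ∈ L[[A]].completeTheory M := mem_completeTheory.2 (Sentence.realize_not M |>.2 h)
      exact (Sentence.realize_not N).1 (N.is_model.realize_of_mem _ this) hN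
    simp only [ψ, Sentence.Realize, Formula.realize_iExs, Formula.realize_relabel] at hM
    obtain ⟨i, hi⟩ := hM
    refine ⟨i 0, ?_⟩
    convert hi using 1
    funext a
    rw [Subsingleton.elim a 0]
    rfl
  let ι := {φ : L[[A]].Formula (Fin 1) // φ.Realize t}
  let F : ι → Filter M := fun φ => 𝓟 {x | φ.1.Realize fun _ => x}
  have : Nonempty ι := ⟨⟨⊤, by simp⟩⟩
  have hne : NeBot (⨅ φ, F φ) := by
    refine iInf_neBot_of_directed' (fun φ ψ => ?_) fun φ => ?_
    · refine ⟨⟨φ.1 ⊓ ψ.1, Formula.realize_inf.2 ⟨φ.2, ψ.2⟩⟩, ?_, ?_⟩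
      · exact principal_mono.2 fun x hx => (Formula.realize_inf.1 hx).1
      · exact principal_mono.2 fun x hx => (Formula.realize_inf.1 hx).2
    · exact principal_neBot_iff.2 (hsat φ.1 φ.2)
  have hev : ∀ φ : L[[A]].Formula (Fin 1), φ.Realize t →
      ∀ᶠ x : M in Ultrafilter.of (⨅ φ, F φ), φ.Realize fun _ => x := fun φ hφ =>
    Ultrafilter.of_le _ (iInf_le F ⟨φ, hφ⟩ (mem_principal_self _))
  refine ⟨Ultrafilter.of (⨅ φ, F φ), fun φ => ?_⟩
  rw [Theory.CompleteType.formula_mem_typeOf]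
  refine ⟨hev φ, fun h => ?_⟩
  by_contra hφ
  obtain ⟨x, hx, hx'⟩ := (h.and (hev φ.not (Formula.realize_not.2 hφ))).exists
  exact Formula.realize_not.1 hx' hx

theorem _root_.Ultrafilter.eventually_iff_eventually {X : Type*} (U : Ultrafilter X)
    (P : X → Prop) : ∀ᶠ x in U, (P x ↔ ∀ᶠ x' in U, P x') := by
  by_cases h : ∀ᶠ x in U, P x
  · filter_upwards [h] with x hx
    exact iff_of_true hx h
  · filter_upwards [Ultrafilter.eventually_not.2 h] with x hx
    exact iff_of_false hx h

open Classical in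
/-- The parameters that the ultrafilter `U` assigns to the descendants of a `U`-random point. -/
noncomputable def limitWord {M : Type w} {k : ℕ} (e : M → Fin k → M) (A : Set M)
    (U : Ultrafilter M) (l : List (Fin k)) : Option (A × List (Fin k)) :=
  if h : ∃ q : A × List (Fin k), ∀ᶠ x in U, l.foldl e x = q.2.foldl e (q.1 : M) then some h.choose
  else none

/-- Two parameter descendants that both equal the word `l` almost everywhere agree at a common
point, so one recorded name determines all such equations. -/
theorem eventually_iff_limitWord {M : Type w} {k : ℕ} {e : M → Fin k → M} {A : Set M}
    {U : Ultrafilter M} {l : List (Fin k)} (q : A × List (Fin k)) :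
    (∀ᶠ x in U, l.foldl e x = q.2.foldl e (q.1 : M)) ↔
      ∃ r ∈ limitWord e A U l, r.2.foldl e (r.1 : M) = q.2.foldl e (q.1 : M) := by
  classical
  constructor
  · intro hq
    have h : ∃ q : A × List (Fin k), ∀ᶠ x in U, l.foldl e x = q.2.foldl e (q.1 : M) := ⟨q, hq⟩
    refine ⟨h.choose, by simp only [limitWord, dif_pos h, Option.mem_def], ?_⟩
    obtain ⟨x, hx, hx'⟩ := (h.choose_spec.and hq).exists
    rw [← hx, hx']
  · rintro ⟨r, hr, h⟩
    rw [← h]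
    by_cases h : ∃ q : A × List (Fin k), ∀ᶠ x in U, l.foldl e x = q.2.foldl e (q.1 : M)
    · simp only [limitWord, dif_pos h, Option.mem_def, Option.some.injEq] at hr
      exact hr ▸ h.choose_spec
    · simp only [limitWord, dif_neg h] at hr
      cases hr

/-- Two types over `A` given by ultrafilters with the same equations between the descendants of
a random point and with descendants of points of `A` are equal. -/
theorem oneType_le_of_limits_eq {M : Type w} [setLang.Structure M] [DecidableEq M] {k : ℕ}
    {ch : M → Finset M} (hM : IsBoundedSetModel k ch) (hmem : ∀ a b, a ∈ ch b ↔ Mem a b)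
    {e : M → Fin k → M} (he : ∀ x, ch x = (Finset.univ.image (e x)).erase x) {A : Set M}
    {p q : OneTypes setLang M A} {U V : Ultrafilter M}
    (hU : ∀ φ : setLang[[A]].Formula (Fin 1),
      Formula.equivSentence φ ∈ p ↔ ∀ᶠ x : M in U, φ.Realize fun _ => x)
    (hV : ∀ φ : setLang[[A]].Formula (Fin 1),
      Formula.equivSentence φ ∈ q ↔ ∀ᶠ x : M in V, φ.Realize fun _ => x)
    (h₁ : ∀ l l' : List (Fin k),
      (∀ᶠ x in U, l.foldl e x = l'.foldl e x) ↔ ∀ᶠ x in V, l.foldl e x = l'.foldl e x)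
    (h₂ : ∀ l l' : List (Fin k), ∀ a ∈ A,
      (∀ᶠ x in U, l.foldl e x = l'.foldl e a) ↔ ∀ᶠ x in V, l.foldl e x = l'.foldl e a) :
    (p : Set setLang[[A]][[Fin 1]].Sentence) ⊆ q := by
  classical
  intro σ hσ
  obtain ⟨φ, rfl⟩ := Formula.equivSentence.surjective σ
  by_contra hφ
  have hφU := (hU φ).1 hσ
  have hφV := Ultrafilter.eventually_not.2 (mt (hV φ).2 hφ)
  obtain ⟨D, F, hDF⟩ := exists_isPreserved hM hmem (BoundedFormula.constantsVarsEquiv φ)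
  let S : Finset M := F.toLeft.image Subtype.val
  have hSA : ∀ s ∈ S, s ∈ A := fun s hs => by
    obtain ⟨a, -, rfl⟩ := Finset.mem_image.1 hs
    exact a.2
  have hfin : {l : List (Fin k) | l.length ≤ D}.Finite := List.finite_length_le _ D
  -- Only finitely many equations matter for `φ`, so almost every point realizes all their limiting
  -- truth values at once.
  have hgood : ∀ W : Ultrafilter M, ∀ᶠ x in W, ∀ l ∈ {l : List (Fin k) | l.length ≤ D},
      ∀ l' ∈ {l : List (Fin k) | l.length ≤ D},
      (l.foldl e x = l'.foldl e x ↔ ∀ᶠ z in W, l.foldl e z = l'.foldl e z) ∧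
      ∀ s ∈ (S : Set M), (l.foldl e x = l'.foldl e s ↔ ∀ᶠ z in W, l.foldl e z = l'.foldl e s) := by
    intro W
    refine (eventually_all_finite hfin).2 fun l _ => (eventually_all_finite hfin).2 fun l' _ => ?_
    refine (W.eventually_iff_eventually _).and ?_
    exact (eventually_all_finite S.finite_toSet).2 fun s _ => W.eventually_iff_eventually _
  obtain ⟨x, hx, hxφ⟩ := ((hgood U).and hφU).exists
  obtain ⟨y, hy, hyφ⟩ := ((hgood V).and hφV).exists
  obtain ⟨f, hf, hfS, hfx⟩ := exists_partialIso_of_words (D := D) (S := S) (x := x) (y := y) he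
    (fun l l' hl hl' => ((hx l hl l' hl').1.trans (h₁ l l')).trans (hy l hl l' hl').1.symm)
    (fun l l' hl hl' s hs => (((hx l hl l' hl').2 s hs).trans (h₂ l l' s (hSA s hs))).trans
      ((hy l hl l' hl').2 s hs).symm)
  refine hyφ ?_
  have hreal : ∀ z : M, (φ.Realize fun _ => z) ↔
      (BoundedFormula.constantsVarsEquiv φ).Realize
        (Sum.elim (fun a : A => (a : M)) fun _ => z) default := fun z =>
    (BoundedFormula.realize_constantsVarsEquiv (φ := φ)).symm
  rw [hreal] at hxφ ⊢
  refine (hDF _ _ default default f (hf.mono le_rfl ?_) ?_ fun i => i.elim0).1 hxφ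
  · intro b hb
    rcases Finset.mem_union.1 hb with hb | hb
    · obtain ⟨i, hi, rfl⟩ := Finset.mem_image.1 hb
      rcases i with a | i
      · exact Finset.mem_insert_of_mem
          (Finset.mem_image_of_mem Subtype.val (Finset.mem_toLeft.2 hi))
      · exact Finset.mem_insert_self _ _
    · simp at hb
  · rintro (a | i) hi
    · exact hfS a (Finset.mem_image_of_mem Subtype.val (Finset.mem_toLeft.2 hi))
    · exact hfx

/-- A type is coded by its limit words, at most `κ ^ ℵ₀` choices, and by the equations among words
at a random point, at most `2 ^ ℵ₀` choices. -/
theorem mk_oneTypes_le {k : ℕ} (hk : 1 ≤ k) {κ : Cardinal.{w}} (hκ : ℵ₀ ≤ κ) {M : Type w}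
    [setLang.Structure M] (hM : M ⊨ theoryS k) {A : Set M} (hA : #A ≤ κ) :
    #(OneTypes setLang M A) ≤ κ ^ ℵ₀ := by
  classical
  obtain ⟨ch, hch, hmem⟩ := exists_isBoundedSetModel hk hM
  obtain ⟨e, he⟩ := hch.exists_enumeration
  choose U hU using fun p : OneTypes setLang M A => exists_ultrafilter_of_oneType p
  let G : OneTypes setLang M A →
      (List (Fin k) → Option (A × List (Fin k))) × (List (Fin k) × List (Fin k) → Prop) :=
    fun p => (limitWord e A (U p), fun l => ∀ᶠ x in U p, l.1.foldl e x = l.2.foldl e x)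
  have hG : Function.Injective G := by
    have hsub : ∀ p q, G p = G q → (p : Set setLang[[A]][[Fin 1]].Sentence) ⊆ q := by
      intro p q h
      have h₁ : limitWord e A (U p) = limitWord e A (U q) := congrArg Prod.fst h
      have h₂ := congrArg Prod.snd h
      refine oneType_le_of_limits_eq hch hmem he (hU p) (hU q)
        (fun l l' => iff_of_eq (congrFun h₂ (l, l'))) fun l l' a ha => ?_
      have hp := eventually_iff_limitWord (e := e) (U := U p) (l := l) ((⟨a, ha⟩, l') : A × _)
      have hq := eventually_iff_limitWord (e := e) (U := U q) (l := l) ((⟨a, ha⟩, l') : A × _)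
      rw [h₁] at hp
      exact hp.trans hq.symm
    exact fun p q h => SetLike.coe_injective ((hsub p q h).antisymm (hsub q p h.symm))
  refine (mk_le_of_injective hG).trans ?_
  have hκ0 : κ ≠ 0 := (aleph0_pos.trans_le hκ).ne'
  have hW : #(List (Fin k)) ≤ ℵ₀ := mk_le_aleph0
  have hWW : #(List (Fin k) × List (Fin k)) ≤ ℵ₀ := mk_le_aleph0
  have hlift : ∀ {c : Cardinal.{0}}, c ≤ ℵ₀ → Cardinal.lift.{w} c ≤ ℵ₀ := fun h => by
    simpa using h
  have hO : #(Option (A × List (Fin k))) ≤ κ := by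
    rw [mk_option, mk_prod]
    refine add_le_of_le hκ ?_ (one_lt_aleph0.le.trans hκ)
    simp only [Cardinal.lift_uzero]
    exact mul_le_of_le hκ (by simpa using hA) ((hlift hW).trans hκ)
  have hle : ∀ {c d : Cardinal.{w}}, c ≤ κ → d ≤ ℵ₀ → c ^ d ≤ κ ^ (ℵ₀ : Cardinal.{w}) :=
    fun hc hd => (power_le_power_right hc).trans (power_le_power_left hκ0 hd)
  have hκω : ℵ₀ ≤ κ ^ (ℵ₀ : Cardinal.{w}) := hκ.trans (self_le_power κ one_lt_aleph0.le)
  rw [mk_prod]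
  refine mul_le_of_le hκω ?_ ?_
  · rw [Cardinal.lift_uzero, mk_arrow]
    simpa using hle hO (hlift hW)
  · rw [mk_arrow]
    simp only [Cardinal.lift_power, Cardinal.lift_lift, mk_Prop, Cardinal.lift_ofNat]
    exact hle ((natCast_lt_aleph0 (n := 2)).le.trans hκ) (hlift (by simpa using hWW))

theorem card_setLang_le : setLang.card ≤ ℵ₀ := by
  have hR : Countable (Σ n, SetRel n) :=
    Function.Injective.countable (f := fun _ : (Σ n, SetRel n) => ())
      fun ⟨_, a⟩ ⟨_, b⟩ _ => by cases a; cases b; rfl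
  have : Countable setLang.Symbols :=
    inferInstanceAs (Countable ((Σ _ : ℕ, Empty) ⊕ Σ n, SetRel n))
  exact mk_le_aleph0

end Types

end VaughtSets

theorem mainTheorem6 (k : ℕ) (hk : 2 ≤ k) :
    (∀ κ : Cardinal.{w}, ℵ₀ ≤ κ →
      ∀ (M : Type w) [VaughtSets.setLang.Structure M], M ⊨ VaughtSets.theoryS k →
        ∀ A : Set M, #A ≤ κ → #(VaughtSets.OneTypes VaughtSets.setLang M A) ≤ κ ^ ℵ₀) ∧
    (∀ κ : Cardinal.{w}, ℵ₀ ≤ κ → κ ^ ℵ₀ = κ →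
      VaughtSets.IsKappaStable.{0, 0, w} (VaughtSets.theoryS k) κ) ∧
    VaughtSets.IsStable.{0, 0, w} (VaughtSets.theoryS k) := by
  have h₁ : ∀ κ : Cardinal.{w}, ℵ₀ ≤ κ →
      ∀ (M : Type w) [VaughtSets.setLang.Structure M], M ⊨ VaughtSets.theoryS k →
        ∀ A : Set M, #A ≤ κ → #(VaughtSets.OneTypes VaughtSets.setLang M A) ≤ κ ^ ℵ₀ :=
    fun κ hκ M _ hM A hA => VaughtSets.mk_oneTypes_le (by omega) hκ hM hA
  have h₂ : ∀ κ : Cardinal.{w}, ℵ₀ ≤ κ → κ ^ ℵ₀ = κ →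
      VaughtSets.IsKappaStable.{0, 0, w} (VaughtSets.theoryS k) κ :=
    fun κ hκ hκω M _ hM A hA => (h₁ κ hκ M hM A hA).trans_eq hκω
  -- The continuum is infinite and equals its own `ℵ₀`-th power.
  refine ⟨h₁, h₂, 2 ^ (ℵ₀ : Cardinal.{w}), ?_, ?_⟩
  · rw [max_eq_left VaughtSets.card_setLang_le, lift_aleph0]
    exact (cantor _).le
  · refine h₂ _ (cantor _).le ?_
    rw [← power_mul, aleph0_mul_aleph0]
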